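/- Let $\mathcal A$ be a non-zero unital complex $C^*$-algebra, let $a\in\mathcal A$, let $\mathcal B$ be a complex linear subspace of $\mathcal A$ (not necessarily closed), and let $b_0$ be a best approximation to $a$ in $\mathcal B$, i.e. $b_0\in\mathcal B$ and $\|a-b_0\|\le\|a-b\|$ for all $b\in\mathcal B$. Let $S_{\mathcal A}$ be the set of states of $\mathcal A$, i.e. of positive linear functionals $\phi$ on $\mathcal A$ with $\phi(1_{\mathcal A})=1$. For $\phi\in S_{\mathcal A}$ let $\mathscr L=\{c\in\mathcal A:\phi(c^*c)=0\}$, a linear subspace of $\mathcal A$, and equip $\mathcal A/\mathscr L$ with the inner product $\langle a_1+\mathscr L\,|\,a_2+\mathscr L\rangle=\phi(a_1^*a_2)$. Write $\mathcal B/\mathscr L=\{b+\mathscr L: b\in\mathcal B\}\subseteq\mathcal A/\mathscr L$, and put $$M_{a,\mathcal B}(\phi)=\sup\Big\{\phi\big((a-b_0)^*(a-b_0)\big)-\sum_\alpha\big|\phi\big((a-b_0)^*b_\alpha\big)\big|^2\Big\},$$ where the supremum is taken over all families $\{b_\alpha\}$ in $\mathcal B$ such that $\{b_\alpha+\mathscr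 L\}$ is an orthonormal basis of $\mathcal B/\mathscr L$, i.e. a maximal orthonormal subset of $\mathcal B/\mathscr L$ (indexed without repetition). Then $$\operatorname{dist}(a,\mathcal B)^2=\max\{M_{a,\mathcal B}(\phi):\phi\in S_{\mathcal A}\};$$ in particular the maximum is attained. -/

import Mathlib

open scoped ComplexOrder InnerProductSpace

noncomputable section

namespace CStarDist

variable {A : Type*} [CStarAlgebra A]

/-- `b₀` is a best approximation to `a` in the subspace `B`. -/
def IsBestApprox (a : A) (B : Submodule ℂ A) (b₀ : A) : Prop :=
  b₀ ∈ B ∧ ∀ b ∈ B, ‖a - b₀‖ ≤ ‖a - b‖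

variable [PartialOrder A] [StarOrderedRing A]

/-- The states of a unital C*-algebra: the positive linear functionals with `φ 1 = 1`. -/
def states (A : Type*) [CStarAlgebra A] [PartialOrder A] [StarOrderedRing A] :
    Set (A →ₚ[ℂ] ℂ) :=
  {φ | φ 1 = 1}

/-- An element of the left kernel is orthogonal to everything (Cauchy-Schwarz). -/
lemma map_star_mul_eq_zero (φ : A →ₚ[ℂ] ℂ) {c : A} (hc : φ (star c * c) = 0) (x : A) :
    φ (star x * c) = 0 := by
  have h0 : ‖φ.toPreGNS c‖ = 0 := by
    have h := φ.preGNS_norm_sq (φ.toPreGNS c)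
    simp only [PositiveLinearMap.ofPreGNS_toPreGNS, hc] at h
    exact_mod_cast pow_eq_zero_iff (two_ne_zero) |>.1 h
  have h1 := norm_inner_le_norm (𝕜 := ℂ) (φ.toPreGNS x) (φ.toPreGNS c)
  rw [h0, mul_zero] at h1
  exact norm_le_zero_iff.1 h1

/-- `φ (x* y)` is the complex conjugate of `φ (y* x)`. -/
lemma conj_map_star_mul (φ : A →ₚ[ℂ] ℂ) (x y : A) :
    (starRingEnd ℂ) (φ (star y * x)) = φ (star x * y) :=
  inner_conj_symm (𝕜 := ℂ) (φ.toPreGNS x) (φ.toPreGNS y)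

/-- The same as `map_star_mul_eq_zero`, in the other variable. -/
lemma map_star_mul_eq_zero' (φ : A →ₚ[ℂ] ℂ) {c : A} (hc : φ (star c * c) = 0) (x : A) :
    φ (star c * x) = 0 := by
  rw [← conj_map_star_mul, map_star_mul_eq_zero φ hc, map_zero]

/-- The left kernel `L = {c | φ (c* c) = 0}` of a positive functional `φ`. -/
def leftKernel (φ : A →ₚ[ℂ] ℂ) : Submodule ℂ A where
  carrier := {c | φ (star c * c) = 0}
  zero_mem' := by simp
  add_mem' {c d} hc hd := by
    simp only [Set.mem_ofPred_eq] at hc hd ⊢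
    rw [mul_add, map_add, map_star_mul_eq_zero φ hc, map_star_mul_eq_zero φ hd, add_zero]
  smul_mem' r c hc := by
    simp only [Set.mem_ofPred_eq] at hc ⊢
    rw [mul_smul_comm, map_smul, map_star_mul_eq_zero φ hc, smul_zero]

lemma mem_leftKernel {φ : A →ₚ[ℂ] ℂ} {c : A} :
    c ∈ leftKernel φ ↔ φ (star c * c) = 0 := Iff.rfl

/-- The vector space `A / L`. It is a separate type (not reducible to the quotient) because it
carries the norm coming from `φ`, and not the quotient norm of the C*-norm. -/
def GNSQuotient (φ : A →ₚ[ℂ] ℂ) : Type _ := A ⧸ leftKernel φ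

instance (φ : A →ₚ[ℂ] ℂ) : AddCommGroup (GNSQuotient φ) :=
  inferInstanceAs (AddCommGroup (A ⧸ leftKernel φ))

instance (φ : A →ₚ[ℂ] ℂ) : Module ℂ (GNSQuotient φ) :=
  inferInstanceAs (Module ℂ (A ⧸ leftKernel φ))

/-- The quotient map `c ↦ c + L` from `A` to `A / L`. -/
def toQuotient (φ : A →ₚ[ℂ] ℂ) : A →ₗ[ℂ] GNSQuotient φ := (leftKernel φ).mkQ

lemma toQuotient_surjective (φ : A →ₚ[ℂ] ℂ) : Function.Surjective (toQuotient φ) :=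
  (leftKernel φ).mkQ_surjective

lemma toQuotient_eq_zero {φ : A →ₚ[ℂ] ℂ} {c : A} :
    toQuotient φ c = 0 ↔ φ (star c * c) = 0 :=
  Submodule.Quotient.mk_eq_zero (leftKernel φ)

/-- The inner product `⟨x + L, y + L⟩ = φ (x* y)` on `A / L`. -/
def quotientInner (φ : A →ₚ[ℂ] ℂ) (u v : GNSQuotient φ) : ℂ :=
  Quotient.liftOn₂' (s₁ := (leftKernel φ).quotientRel) (s₂ := (leftKernel φ).quotientRel) u v
    (fun x y => φ (star x * y)) (by
      intro x₁ y₁ x₂ y₂ hx hy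
      rw [Submodule.quotientRel_def, mem_leftKernel] at hx hy
      have h1 := map_star_mul_eq_zero' φ hx y₁
      have h2 := map_star_mul_eq_zero φ hy x₂
      rw [star_sub, sub_mul, map_sub, sub_eq_zero] at h1
      rw [mul_sub, map_sub, sub_eq_zero] at h2
      exact h1.trans h2)

lemma quotientInner_mk (φ : A →ₚ[ℂ] ℂ) (x y : A) :
    quotientInner φ (toQuotient φ x) (toQuotient φ y) = φ (star x * y) := rfl

/-- `A / L` is an inner product space. -/
@[reducible]
def quotientCore (φ : A →ₚ[ℂ] ℂ) : InnerProductSpace.Core ℂ (GNSQuotient φ) where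
  inner := quotientInner φ
  conj_inner_symm u v := by
    obtain ⟨x, rfl⟩ := toQuotient_surjective φ u
    obtain ⟨y, rfl⟩ := toQuotient_surjective φ v
    exact conj_map_star_mul φ x y
  re_inner_nonneg u := by
    obtain ⟨x, rfl⟩ := toQuotient_surjective φ u
    exact (RCLike.nonneg_iff.mp (φ.map_nonneg (star_mul_self_nonneg x))).1
  add_left u v w := by
    obtain ⟨x, rfl⟩ := toQuotient_surjective φ u
    obtain ⟨y, rfl⟩ := toQuotient_surjective φ v
    obtain ⟨z, rfl⟩ := toQuotient_surjective φ w
    rw [← map_add, quotientInner_mk, quotientInner_mk, quotientInner_mk, star_add, add_mul,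
      map_add]
  smul_left u v r := by
    obtain ⟨x, rfl⟩ := toQuotient_surjective φ u
    obtain ⟨y, rfl⟩ := toQuotient_surjective φ v
    rw [← map_smul, quotientInner_mk, quotientInner_mk, star_smul, smul_mul_assoc, map_smul]
    rfl
  definite u hu := by
    obtain ⟨x, rfl⟩ := toQuotient_surjective φ u
    exact toQuotient_eq_zero.2 hu

instance (φ : A →ₚ[ℂ] ℂ) : NormedAddCommGroup (GNSQuotient φ) :=
  (quotientCore φ).toNormedAddCommGroup

instance (φ : A →ₚ[ℂ] ℂ) : InnerProductSpace ℂ (GNSQuotient φ) :=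
  InnerProductSpace.ofCore (quotientCore φ).toCore

lemma inner_toQuotient (φ : A →ₚ[ℂ] ℂ) (x y : A) :
    ⟪toQuotient φ x, toQuotient φ y⟫_ℂ = φ (star x * y) := rfl

/-- `S` is an orthonormal basis of the subspace `W` of an inner product space `V`: a maximal
orthonormal subset of `W`. Neither `V` nor `W` has to be complete. -/
def IsOrthonormalBasis {V : Type*} [NormedAddCommGroup V] [InnerProductSpace ℂ V]
    (W : Submodule ℂ V) (S : Set V) : Prop :=
  Maximal (fun T : Set V => T ⊆ W ∧ Orthonormal ℂ ((↑) : T → V)) S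

/-- The elements of `T` represent, without repetition, an orthonormal basis of
`B / L = {b + L | b ∈ B}` in `A / L`; that is, `T = {b_α}` is a family in `B` such that
`{b_α + L}` is an orthonormal basis. -/
def RepresentsBasis (φ : A →ₚ[ℂ] ℂ) (B : Submodule ℂ A) (T : Set A) : Prop :=
  T ⊆ B ∧ Set.InjOn (toQuotient φ) T ∧
    IsOrthonormalBasis (B.map (toQuotient φ)) (toQuotient φ '' T)

/-- The number `φ (x* x) - ∑_α |φ (x* b_α)|²` for a family `T = {b_α}`. -/
def defect (φ : A →ₚ[ℂ] ℂ) (x : A) (T : Set A) : ℝ :=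
  (φ (star x * x)).re - ∑' b : T, ‖φ (star x * (b : A))‖ ^ 2

/-- `M(φ)`: the supremum of `φ ((a-b₀)* (a-b₀)) - ∑_α |φ ((a-b₀)* b_α)|²` over all orthonormal
bases `{b_α + L}` of `B / L` in `A / L`. -/
def M (a : A) (B : Submodule ℂ A) (b₀ : A) (φ : A →ₚ[ℂ] ℂ) : ℝ :=
  sSup {r | ∃ T : Set A, RepresentsBasis φ B T ∧ r = defect φ (a - b₀) T}

/-! The sums and the supremum in `M` are meaningful: the sums converge, there is at least one
orthonormal basis, and the numbers are bounded above. -/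

lemma RepresentsBasis.orthonormal {φ : A →ₚ[ℂ] ℂ} {B : Submodule ℂ A} {T : Set A}
    (h : RepresentsBasis φ B T) : Orthonormal ℂ (fun b : T => toQuotient φ (b : A)) :=
  h.2.2.prop.2.comp (fun b : T => ⟨toQuotient φ b, Set.mem_image_of_mem _ b.2⟩)
    (fun b c hbc => Subtype.ext (h.2.1 b.2 c.2 (congrArg Subtype.val hbc)))

lemma RepresentsBasis.summable {φ : A →ₚ[ℂ] ℂ} {B : Submodule ℂ A} {T : Set A}
    (h : RepresentsBasis φ B T) (x : A) :
    Summable (fun b : T => ‖φ (star x * (b : A))‖ ^ 2) := by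
  refine (h.orthonormal.inner_products_summable (toQuotient φ x)).congr fun b => ?_
  rw [norm_inner_symm, inner_toQuotient]

lemma exists_representsBasis (φ : A →ₚ[ℂ] ℂ) (B : Submodule ℂ A) :
    ∃ T : Set A, RepresentsBasis φ B T := by
  obtain ⟨S, -, hS⟩ := zorn_subset_nonempty
    {T : Set (GNSQuotient φ) | T ⊆ B.map (toQuotient φ) ∧
      Orthonormal ℂ ((↑) : T → GNSQuotient φ)}
    (fun c hc hch _ => ⟨⋃₀ c, ⟨Set.sUnion_subset fun s hs => (hc hs).1,
      orthonormal_sUnion_of_directed hch.directedOn fun s hs => (hc hs).2⟩,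
      fun s hs => Set.subset_sUnion_of_mem hs⟩)
    ∅ ⟨Set.empty_subset _, orthonormal_empty ℂ _⟩
  obtain ⟨T, hTB, hT⟩ := Set.SurjOn.exists_bijOn_subset
    (f := toQuotient φ) (s := (B : Set A)) (t := S) (fun s hs => hS.prop.1 hs)
  exact ⟨T, hTB, hT.injOn, hT.image_eq.symm ▸ hS⟩

lemma bddAbove_defect (x : A) (B : Submodule ℂ A) (φ : A →ₚ[ℂ] ℂ) :
    BddAbove {r | ∃ T : Set A, RepresentsBasis φ B T ∧ r = defect φ x T} := by
  refine ⟨(φ (star x * x)).re, ?_⟩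
  rintro r ⟨T, -, rfl⟩
  exact sub_le_self _ (tsum_nonneg fun b => by positivity)

end CStarDist

end

noncomputable section

namespace CStarDist

variable {A : Type*} [CStarAlgebra A]

/-! Put `x = a - b₀`. Every defect is at most `φ (x* x) ≤ ‖x‖²`, so only attainment needs work. It
suffices to find a state with `φ (x* x) = ‖x‖²` and `φ (x* b) = 0` on `B`
(`exists_state_norm_sq_orthogonal`): the sums then vanish for every basis. Such a state has to
annihilate the complex subspace `ℂ N + x* B`, where `N = x* x - ‖x‖²`. Hahn-Banach supplies it
(`exists_state_eq_zero_on`) once this subspace misses the open convex cone `strictlyDissipative A`.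
An element in both would give a small step from `x` along `B` that lowers the norm
(`smul_add_notMem_strictlyDissipative`), against the minimality of `‖x‖`. -/

lemma IsBestApprox.infDist_eq {a : A} {B : Submodule ℂ A} {b₀ : A} (h : IsBestApprox a B b₀) :
    Metric.infDist a (B : Set A) = ‖a - b₀‖ := by
  refine le_antisymm ?_ ((Metric.le_infDist ⟨b₀, h.1⟩).2 fun b hb => ?_)
  · exact (Metric.infDist_le_dist_of_mem h.1).trans_eq (dist_eq_norm _ _)
  · exact (h.2 b hb).trans_eq (dist_eq_norm _ _).symm

lemma IsBestApprox.norm_sub_le_norm_sub_add {a : A} {B : Submodule ℂ A} {b₀ : A}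
    (h : IsBestApprox a B b₀) {b : A} (hb : b ∈ B) : ‖a - b₀‖ ≤ ‖a - b₀ + b‖ := by
  rw [sub_add]
  exact h.2 _ (B.sub_mem h.1 hb)

variable [PartialOrder A] [StarOrderedRing A]

/-- The elements whose real part is bounded above by a negative scalar. -/
def strictlyDissipative (A : Type*) [CStarAlgebra A] [PartialOrder A] : Set A :=
  {c | ∃ ε : ℝ, 0 < ε ∧ c + star c ≤ algebraMap ℝ A (-ε)}

lemma algebraMap_real_mono {r s : ℝ} (h : r ≤ s) : algebraMap ℝ A r ≤ algebraMap ℝ A s := by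
  rw [← sub_nonneg, ← map_sub, Algebra.algebraMap_eq_smul_one]
  exact smul_nonneg (sub_nonneg.2 h) zero_le_one

lemma le_algebraMap_nonneg [Nontrivial A] {c : A} (hc : 0 ≤ c) {r : ℝ}
    (h : c ≤ algebraMap ℝ A r) : 0 ≤ r := by
  by_contra! hr
  have h1 : algebraMap ℝ A r ≤ algebraMap ℝ A 0 := algebraMap_real_mono hr.le
  rw [map_zero] at h1
  have h2 : algebraMap ℝ A r = 0 := le_antisymm h1 (hc.trans h)
  rw [map_eq_zero_iff _ (algebraMap ℝ A).injective] at h2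
  exact hr.ne h2

lemma isOpen_strictlyDissipative : IsOpen (strictlyDissipative A) := by
  rw [Metric.isOpen_iff]
  rintro c ⟨ε, hε, hc⟩
  -- Moving `c` by less than `ε / 4` moves `c + star c` by at most `ε / 2`.
  refine ⟨ε / 4, by positivity, fun d hd => ⟨ε / 2, by positivity, ?_⟩⟩
  rw [mem_ball_iff_norm] at hd
  have hsa : IsSelfAdjoint (d - c + star (d - c)) := IsSelfAdjoint.add_star_self _
  have hle : ‖d - c + star (d - c)‖ ≤ ε / 2 := by
    refine (norm_add_le _ _).trans ?_
    rw [norm_star]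
    linarith
  have h := add_le_add (hsa.le_algebraMap_norm_self.trans (algebraMap_real_mono hle)) hc
  rw [← map_add] at h
  convert h using 1
  · rw [star_sub]; abel
  · congr 1; ring

lemma add_mem_strictlyDissipative {c d : A} (hc : c ∈ strictlyDissipative A)
    (hd : d ∈ strictlyDissipative A) : c + d ∈ strictlyDissipative A := by
  obtain ⟨ε, hε, hc⟩ := hc
  obtain ⟨δ, hδ, hd⟩ := hd
  refine ⟨ε + δ, add_pos hε hδ, ?_⟩
  rw [neg_add, map_add, star_add, add_add_add_comm]
  exact add_le_add hc hd

lemma smul_mem_strictlyDissipative {c : A} (hc : c ∈ strictlyDissipative A) {t : ℝ}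
    (ht : 0 < t) : t • c ∈ strictlyDissipative A := by
  obtain ⟨ε, hε, hc⟩ := hc
  refine ⟨t * ε, mul_pos ht hε, ?_⟩
  have h := smul_le_smul_of_nonneg_left hc ht.le
  rw [star_smul, star_trivial, ← smul_add]
  refine h.trans_eq ?_
  rw [← mul_neg, map_mul, ← Algebra.smul_def]

lemma convex_strictlyDissipative : Convex ℝ (strictlyDissipative A) :=
  convex_iff_forall_pos.2 fun _ hc _ hd _ _ ht hs _ =>
    add_mem_strictlyDissipative (smul_mem_strictlyDissipative hc ht)
      (smul_mem_strictlyDissipative hd hs)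

lemma sub_one_mem_strictlyDissipative {c : A} (hc : c + star c ≤ 0) :
    c - 1 ∈ strictlyDissipative A := by
  refine ⟨2, two_pos, ?_⟩
  have h : c - 1 + star (c - 1) = (c + star c) + algebraMap ℝ A (-2) := by
    rw [star_sub, star_one, map_neg, map_ofNat, ← one_add_one_eq_two]
    abel
  rw [h]
  exact add_le_of_nonpos_left hc

/-- A complex subspace without strictly dissipative elements is annihilated by a state. -/
theorem exists_state_eq_zero_on (W : Submodule ℂ A)
    (hW : Disjoint (strictlyDissipative A) (W : Set A)) :
    ∃ φ ∈ states A, ∀ w ∈ W, φ w = 0 := by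
  obtain ⟨f, u, hs, ht⟩ := RCLike.geometric_hahn_banach_open (𝕜 := ℂ)
    convex_strictlyDissipative isOpen_strictlyDissipative (W.restrictScalars ℝ).convex hW
  have hu : u ≤ 0 := by simpa using ht 0 W.zero_mem
  have hneg (c : A) (hc : c + star c ≤ 0) : (f c).re < (f 1).re := by
    have h := (hs _ (sub_one_mem_strictlyDissipative hc)).trans_le hu
    simpa using h
  have hone : 0 < (f 1).re := by simpa using hneg 0 (by simp)
  -- The condition on `c` survives positive scaling, so a positive value could be rescaled to equal
  -- `(f 1).re`, against `hneg`.
  have hre (c : A) (hc : c + star c ≤ 0) : (f c).re ≤ 0 := by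
    by_contra! h
    have hk : 0 ≤ (f 1).re / (f c).re := by positivity
    have h2 := hneg (((f 1).re / (f c).re : ℝ) • c) (by
      rw [star_smul, star_trivial, ← smul_add]
      exact smul_nonpos_of_nonneg_of_nonpos hk hc)
    rw [← Complex.coe_smul, map_smul, smul_eq_mul, Complex.re_ofReal_mul,
      div_mul_cancel₀ _ h.ne'] at h2
    exact h2.false
  -- Both `i c` and `-i c` have real part zero, so `hre` applies to each.
  have him (c : A) (hc : IsSelfAdjoint c) : (f c).im = 0 := by
    have h1 := hre (Complex.I • c) (by simp [star_smul, hc.star_eq])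
    have h2 := hre (-(Complex.I • c)) (by simp [star_smul, hc.star_eq])
    simp at h1 h2
    linarith
  have hpos (c : A) (hc : 0 ≤ c) : 0 ≤ f c := by
    rw [Complex.nonneg_iff]
    refine ⟨?_, (him c (IsSelfAdjoint.of_nonneg hc)).symm⟩
    have h := hre (-c) (by
      rw [star_neg, (IsSelfAdjoint.of_nonneg hc).star_eq]
      exact add_nonpos (neg_nonpos.2 hc) (neg_nonpos.2 hc))
    simpa using h
  have hf1 : f 1 ≠ 0 := fun h => by simp [h] at hone
  refine ⟨PositiveLinearMap.mk₀ ((f 1)⁻¹ • (f : A →ₗ[ℂ] ℂ)) fun c hc => ?_, ?_, fun w hw => ?_⟩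
  · exact mul_nonneg (inv_nonneg.2 (hpos 1 zero_le_one)) (hpos c hc)
  · exact inv_mul_cancel₀ hf1
  · suffices h : f w = 0 by
      change (f 1)⁻¹ * f w = 0
      rw [h, mul_zero]
    by_contra h
    -- This multiple of `w` takes the value `u - 1`, below the bound `u` valid on `W`.
    have h2 := ht (((u - 1 : ℝ) / f w : ℂ) • w) (W.smul_mem _ hw)
    rw [map_smul, smul_eq_mul, div_mul_cancel₀ _ h] at h2
    simp at h2
    linarith

/-- For `y = x + S⁻¹ b` one has `y* y = ‖x‖² + S⁻¹ (S N + x* b + b* x) + S⁻² b* b`. Membership would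
bound this by `‖x‖² - ε / S + ‖b‖² / S²`, which is below `‖x‖²` for large `S`. -/
lemma smul_add_notMem_strictlyDissipative [Nontrivial A] {x b : A}
    (hx : ∀ t : ℝ, ‖x‖ ≤ ‖x + t • b‖) (z : ℂ) :
    z • (star x * x - algebraMap ℝ A (‖x‖ ^ 2)) + star x * b ∉ strictlyDissipative A := by
  rintro ⟨ε, hε, h⟩
  set N : A := star x * x - algebraMap ℝ A (‖x‖ ^ 2) with hN
  have hN0 : N ≤ 0 := sub_nonpos.2 CStarAlgebra.star_mul_le_algebraMap_norm_sq
  have hNsa : star N = N := by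
    rw [hN, star_sub, star_mul, star_star, ← algebraMap_star_comm,
      star_trivial (‖x‖ ^ 2)]
  -- As `N ≤ 0`, the bound `2 * z.re ≤ S` allows `S` to replace the coefficient `2 * z.re` of `N`;
  -- the last bound makes the linear gain beat the quadratic term.
  obtain ⟨S, hS0, hSz, hSb⟩ : ∃ S : ℝ, 0 < S ∧ 2 * z.re ≤ S ∧ ‖b‖ ^ 2 < S * ε := by
    refine ⟨max (2 * z.re) 0 + (‖b‖ ^ 2 / ε + 1), by positivity, ?_, ?_⟩
    · have := le_max_left (2 * z.re) 0
      have : 0 ≤ ‖b‖ ^ 2 / ε := by positivity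
      linarith
    · have h1 : ‖b‖ ^ 2 / ε * ε = ‖b‖ ^ 2 := div_mul_cancel₀ _ hε.ne'
      have h2 : 0 ≤ max (2 * z.re) 0 * ε := mul_nonneg (le_max_right _ _) hε.le
      nlinarith
  have h1 : S • N + (star x * b + star b * x) ≤ algebraMap ℝ A (-ε) := by
    refine le_trans ?_ h
    have e : z • N + star x * b + star (z • N + star x * b)
        = (2 * z.re) • N + (star x * b + star b * x) := by
      have e2 : z • N + star z • N = (2 * z.re) • N := by
        rw [← add_smul, ← Complex.coe_smul]
        congr 1
        exact Complex.add_conj z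
      rw [star_add, star_smul, hNsa, star_mul, star_star, ← e2]
      abel
    rw [e]
    gcongr ?_ + _
    rw [← sub_nonneg, ← sub_smul]
    exact smul_nonneg_of_nonpos_of_nonpos (sub_nonpos.2 hSz) hN0
  set y : A := x + S⁻¹ • b with hy
  have e : star y * y = algebraMap ℝ A (‖x‖ ^ 2)
      + S⁻¹ • (S • N + (star x * b + star b * x)) + (S⁻¹ * S⁻¹) • (star b * b) := by
    rw [smul_add, inv_smul_smul₀ hS0.ne', hN, hy, star_add, star_smul,
      star_trivial S⁻¹]
    simp only [add_mul, mul_add, smul_mul_assoc, mul_smul_comm, smul_smul, smul_add]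
    abel
  have h2 : star y * y ≤ algebraMap ℝ A (‖x‖ ^ 2 - S⁻¹ * S⁻¹ * (S * ε - ‖b‖ ^ 2)) := by
    have h3 : algebraMap ℝ A (‖x‖ ^ 2 - S⁻¹ * S⁻¹ * (S * ε - ‖b‖ ^ 2))
        = algebraMap ℝ A (‖x‖ ^ 2) + S⁻¹ • algebraMap ℝ A (-ε)
          + (S⁻¹ * S⁻¹) • algebraMap ℝ A (‖b‖ ^ 2) := by
      simp only [Algebra.smul_def, ← map_mul, ← map_add]
      congr 1
      field_simp
      ring
    rw [e, h3]
    have := hS0.le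
    gcongr
    exact CStarAlgebra.star_mul_le_algebraMap_norm_sq
  have h4 := (CStarAlgebra.norm_le_iff_le_algebraMap _
    (le_algebraMap_nonneg (star_mul_self_nonneg y) h2) (star_mul_self_nonneg y)).2 h2
  rw [CStarRing.norm_star_mul_self, ← sq] at h4
  have h5 : ‖x‖ ^ 2 ≤ ‖y‖ ^ 2 := by
    gcongr
    exact hx S⁻¹
  have h6 : 0 < S⁻¹ * S⁻¹ * (S * ε - ‖b‖ ^ 2) :=
    mul_pos (by positivity) (sub_pos.2 hSb)
  linarith

/-- If `x` is Birkhoff-James orthogonal to the subspace `B`, then some state attains the norm of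
`x` and makes `x` orthogonal to `B`. -/
theorem exists_state_norm_sq_orthogonal [Nontrivial A] {x : A} {B : Submodule ℂ A}
    (hx : ∀ b ∈ B, ‖x‖ ≤ ‖x + b‖) :
    ∃ φ ∈ states A, φ (star x * x) = (‖x‖ ^ 2 : ℝ) ∧ ∀ b ∈ B, φ (star x * b) = 0 := by
  set N : A := star x * x - algebraMap ℝ A (‖x‖ ^ 2) with hN
  obtain ⟨φ, hφ, h⟩ := exists_state_eq_zero_on
    (Submodule.span ℂ {N} ⊔ B.map (LinearMap.mulLeft ℂ (star x))) (by
      rw [Set.disjoint_right]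
      intro w hw
      obtain ⟨n, hn, v, hv, rfl⟩ := Submodule.mem_sup.1 hw
      obtain ⟨z, rfl⟩ := Submodule.mem_span_singleton.1 hn
      obtain ⟨b, hb, rfl⟩ := hv
      exact smul_add_notMem_strictlyDissipative
        (fun t => hx _ ((B.restrictScalars ℝ).smul_mem t hb)) z)
  refine ⟨φ, hφ, ?_, fun b hb =>
    h _ (Submodule.mem_sup_right (Submodule.mem_map_of_mem hb))⟩
  have h0 := h N (Submodule.mem_sup_left (Submodule.mem_span_singleton_self N))
  rw [hN, map_sub, sub_eq_zero] at h0
  rw [h0, Algebra.algebraMap_eq_smul_one, ← Complex.coe_smul, map_smul,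
    show φ 1 = 1 from hφ, smul_eq_mul, mul_one]

lemma state_star_mul_self_re_le {φ : A →ₚ[ℂ] ℂ} (hφ : φ ∈ states A) (x : A) :
    (φ (star x * x)).re ≤ ‖x‖ ^ 2 := by
  have h : φ (star x * x) ≤ φ (algebraMap ℝ A (‖x‖ ^ 2)) :=
    OrderHomClass.mono φ CStarAlgebra.star_mul_le_algebraMap_norm_sq
  rw [Algebra.algebraMap_eq_smul_one, ← Complex.coe_smul, map_smul,
    show φ 1 = 1 from hφ, smul_eq_mul, mul_one] at h
  exact (Complex.le_def.1 h).1

/-- Any `T` will do: a divergent `tsum` is `0`, so the subtracted sum is nonnegative in every case.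
-/
lemma defect_le_norm_sq {φ : A →ₚ[ℂ] ℂ} (hφ : φ ∈ states A) (x : A) (T : Set A) :
    defect φ x T ≤ ‖x‖ ^ 2 :=
  (sub_le_self _ (tsum_nonneg fun _ => by positivity)).trans (state_star_mul_self_re_le hφ x)

end CStarDist

end

theorem mainTheorem2 {A : Type*} [CStarAlgebra A] [Nontrivial A] [PartialOrder A]
    [StarOrderedRing A] (a : A) (B : Submodule ℂ A) (b₀ : A)
    (hb₀ : CStarDist.IsBestApprox a B b₀) :
    IsGreatest (CStarDist.M a B b₀ '' CStarDist.states A)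
      (Metric.infDist a (B : Set A) ^ 2) := by
  rw [hb₀.infDist_eq]
  constructor
  · obtain ⟨φ, hφ, hnorm, horth⟩ := CStarDist.exists_state_norm_sq_orthogonal
      (fun b hb => hb₀.norm_sub_le_norm_sub_add (b := b) hb)
    refine ⟨φ, hφ, ?_⟩
    have hdefect (T : Set A) (hT : CStarDist.RepresentsBasis φ B T) :
        CStarDist.defect φ (a - b₀) T = ‖a - b₀‖ ^ 2 := by
      have h (b : T) : ‖φ (star (a - b₀) * (b : A))‖ ^ 2 = 0 := by
        rw [horth b (hT.1 b.2), norm_zero, sq, mul_zero]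
      rw [CStarDist.defect, hnorm, tsum_congr h, tsum_zero, sub_zero, Complex.ofReal_re]
    -- All bases give the same defect, and the existence of one makes the set a singleton rather
    -- than empty.
    have hset : {r | ∃ T : Set A, CStarDist.RepresentsBasis φ B T ∧
        r = CStarDist.defect φ (a - b₀) T} = {‖a - b₀‖ ^ 2} := by
      ext r
      constructor
      · rintro ⟨T, hT, rfl⟩
        exact hdefect T hT
      · rintro rfl
        obtain ⟨T, hT⟩ := CStarDist.exists_representsBasis φ B
        exact ⟨T, hT, (hdefect T hT).symm⟩
    rw [CStarDist.M, hset, csSup_singleton]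
  · rintro _ ⟨φ, hφ, rfl⟩
    obtain ⟨T, hT⟩ := CStarDist.exists_representsBasis φ B
    refine csSup_le ⟨_, T, hT, rfl⟩ ?_
    rintro _ ⟨T, -, rfl⟩
    exact CStarDist.defect_le_norm_sq hφ _ T
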